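/- Let $f:[0,1]\to\mathbb R$ be convex with $\lim_{x\to+0}f(x)=0=f(0)$ and $f(1)=0$, and differentiable on $(0,1)$ with derivative $f'$. Let $(p_{ij})$, $1\le i\le R$, $1\le j\le C$, be cell probabilities of an $R\times C$ table ($p_{ij}\ge 0$, $\sum_{i,j}p_{ij}=1$), and put $p_{i\cdot}=\sum_j p_{ij}$, $p_{\cdot j}=\sum_i p_{ij}$. Assume $p_{\cdot j}>0$ for all $j$ and $\sum_{j}f(p_{\cdot j})\neq 0$. Let \[ \Phi_{Gf}=\frac{-\sum_{j=1}^C f(p_{\cdot j})-\prod_{i=1}^R\Bigl[-\sum_{j=1}^C f\bigl(\tfrac{p_{ij}}{p_{i\cdot}}\bigr)\Bigr]^{p_{i\cdot}}}{-\sum_{j=1}^C f(p_{\cdot j})}, \] where a row with $p_{i\cdot}=0$ contributes the factor $1$ to the product. For each $n$ let the cell counts $(n_{ij})$ have the multinomial distribution with $n$ trials and cell probabilities $(p_{ij})$, and let $\widehat\Phi_{Gf}$ be the plug-in estimator, obtained from $\Phi_{Gf}$ by replacing every $p_{ij}$ with $n_{ij}/n$ (its value where the denominator vanishes is immaterial;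 say $0$). Then, as $n\to\infty$, $\sqrt n\,(\widehat\Phi_{Gf}-\Phi_{Gf})$ converges in distribution to the normal distribution $N(0,\sigma^2[\Phi_{Gf}])$, where \[ \sigma^2[\Phi_{Gf}]=\bigl(\delta^{(f)}\bigr)^2\Bigl[\sum_{i=1}^R\sum_{j=1}^C p_{ij}\bigl(\Delta_{ij}^{(f)}\bigr)^2-\Bigl(\sum_{i=1}^R\sum_{j=1}^C p_{ij}\Delta_{ij}^{(f)}\Bigr)^2\Bigr]\ \ge 0, \] \[ \delta^{(f)}=\frac{\prod_{s=1}^R\bigl[-\sum_{t=1}^C f(p_{st}/p_{s\cdot})\bigr]^{p_{s\cdot}}}{\bigl(\sum_{t=1}^C f(p_{\cdot t})\bigr)^2},\qquad \Delta_{ij}^{(f)}=f'(p_{\cdot j})-\varepsilon_{ij}^{(f)}\sum_{t=1}^C f(p_{\cdot t}), \] \[ \varepsilon_{ij}^{(f)}=\log\Bigl[-\sum_{t=1}^C f\bigl(\tfrac{p_{it}}{p_{i\cdot}}\bigr)\Bigr]+\frac{\sum_{t=1}^C\bigl\{-\tfrac{p_{it}}{p_{i\cdot}}f'\bigl(\tfrac{p_{it}}{p_{i\cdot}}\bigr)\bigr\}+f'\bigl(\tfrac{p_{ij}}{p_{i\cdot}}\bigr)}{\sum_{t=1}^C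 f\bigl(\tfrac{p_{it}}{p_{i\cdot}}\bigr)}. \] In these sums the terms that carry a factor $p_{ij}=0$ or $p_{it}=0$ are $0$; and if $\delta^{(f)}=0$ (some row with $p_{i\cdot}>0$ has conditional variation $0$), then $\sigma^2[\Phi_{Gf}]=0$ and the limit is the point mass at $0$. -/

import Mathlib

open MeasureTheory ProbabilityTheory Filter Topology

namespace GeoPRV

/-- The conditions on the function `f` that generates the measure of variation: `f` is convex,
`f(x) → 0` as `x → 0+`, and `f(1) = 0`. Only arguments in `[0, 1]` ever occur. The value at `0` is
the limit value `0`. The convention `0 * f (0 / 0) = 0` holds by itself, since `0 / 0 = 0` for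
real numbers here. -/
structure IsGenerator (f : ℝ → ℝ) : Prop where
  convexOn : ConvexOn ℝ (Set.Icc 0 1) f
  map_zero : f 0 = 0
  tendsto_zero : Tendsto f (𝓝[>] 0) (𝓝 0)
  map_one : f 1 = 0

variable {R C : ℕ}

/-- Row marginal `p_{i·}`. -/
def rowSum (p : Fin R → Fin C → ℝ) (i : Fin R) : ℝ := ∑ j, p i j

/-- Column marginal `p_{·j}`. -/
def colSum (p : Fin R → Fin C → ℝ) (j : Fin C) : ℝ := ∑ i, p i j

/-- Variation of the marginal distribution of the response, `V(Y) = - ∑_j f(p_{·j})`. -/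
def marginalVariation (f : ℝ → ℝ) (p : Fin R → Fin C → ℝ) : ℝ :=
  - ∑ j, f (colSum p j)

/-- Variation of the conditional distribution in row `i`,
`V(Y | X = i) = - ∑_j f(p_{ij} / p_{i·})`. -/
noncomputable def conditionalVariation (f : ℝ → ℝ) (p : Fin R → Fin C → ℝ) (i : Fin R) : ℝ :=
  - ∑ j, f (p i j / rowSum p i)

/-- Weighted geometric mean of the conditional variations, `∏_i V(Y | X = i) ^ p_{i·}`
(a row with `p_{i·} = 0` contributes the factor `1`). -/
noncomputable def geoMeanVariation (f : ℝ → ℝ) (p : Fin R → Fin C → ℝ) : ℝ :=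
  ∏ i, conditionalVariation f p i ^ rowSum p i

/-- The measure `Φ_{Gf}`: geometric mean type proportional reduction in variation. -/
noncomputable def phi (f : ℝ → ℝ) (p : Fin R → Fin C → ℝ) : ℝ :=
  (marginalVariation f p - geoMeanVariation f p) / marginalVariation f p

/-- The number `δ^{(f)}`. -/
noncomputable def delta (f : ℝ → ℝ) (p : Fin R → Fin C → ℝ) : ℝ :=
  geoMeanVariation f p / (∑ t, f (colSum p t)) ^ 2

/-- The number `ε_{ij}^{(f)}`. Summands with `p_{it} = 0` vanish, whatever `deriv f 0` is. -/
noncomputable def eps (f : ℝ → ℝ) (p : Fin R → Fin C → ℝ) (i : Fin R) (j : Fin C) : ℝ :=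
  Real.log (conditionalVariation f p i) +
    ((∑ t, -(p i t / rowSum p i * deriv f (p i t / rowSum p i))) + deriv f (p i j / rowSum p i)) /
      ∑ t, f (p i t / rowSum p i)

/-- The number `Δ_{ij}^{(f)}`. -/
noncomputable def Delta (f : ℝ → ℝ) (p : Fin R → Fin C → ℝ) (i : Fin R) (j : Fin C) : ℝ :=
  deriv f (colSum p j) - eps f p i j * ∑ t, f (colSum p t)

/-- The asymptotic variance `σ²[Φ_{Gf}]`. -/
noncomputable def sigmaSq (f : ℝ → ℝ) (p : Fin R → Fin C → ℝ) : ℝ :=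
  delta f p ^ 2 *
    ((∑ i, ∑ j, p i j * Delta f p i j ^ 2) - (∑ i, ∑ j, p i j * Delta f p i j) ^ 2)

/-- The random table of counts `N` has, under `μ`, the multinomial distribution with `n` trials
and cell probabilities `p`. -/
structure IsMultinomial {Ω : Type*} [MeasurableSpace Ω] (N : Ω → Fin R → Fin C → ℕ) (n : ℕ)
    (p : Fin R → Fin C → ℝ) (μ : Measure Ω) : Prop where
  measurable : Measurable N
  prob_eq : ∀ k : Fin R → Fin C → ℕ, μ.real {ω | N ω = k} =
    if ∑ i, ∑ j, k i j = n then
      (Nat.multinomial Finset.univ (fun c : Fin R × Fin C => k c.1 c.2) : ℝ) *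
        ∏ i, ∏ j, p i j ^ k i j
    else 0

/-- The table of observed proportions `n_{ij} / n`. -/
noncomputable def proportions (n : ℕ) (k : Fin R → Fin C → ℕ) : Fin R → Fin C → ℝ :=
  fun i j => (k i j : ℝ) / (n : ℝ)

end GeoPRV

/-!
The theorem is the delta method for the plug-in estimator of `Φ_{Gf}`. The observed proportions
`p̂` satisfy a central limit theorem, `Φ_{Gf}` is differentiable at `p` along the tables that `p̂`
can reach, and `σ²[Φ_{Gf}]` is the variance under `p` of its gradient, whose `(i, j)` entry is
`-δ Δ_{ij}`.

*Probability.* The multinomial theorem gives the generating function of the counts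
(`IsMultinomial.integral_prod_pow`), so that the characteristic function of a linear functional of
`√n (p̂ - p)` is the `n`-th power of the characteristic function of a centered law with finitely
many atoms, taken at `t / √n`. Its limit is Gaussian (`tendsto_sum_exp_pow`), and Lévy's theorem
gives convergence in distribution of all linear functionals (`tendstoInDistribution_linear`) and
tightness of `√n ‖p̂ - p‖` (`exists_measureReal_norm_proportions_sub_le`). Tightness makes the
linearization error of a differentiable function negligible
(`tendsto_measureReal_linearization_error`), and a version of Slutsky's lemma in which the sample
space may depend on `n` (`tendstoInDistribution_of_tendsto_measureReal_sub`) finishes the argument.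

*Analysis.* `Φ_{Gf}` need not be differentiable at `p` when some `p_{ij}` vanish, because `f` may
have infinite slope at `0`. But a cell of probability `0` almost surely has count `0`, so it
suffices to differentiate along the set `supportedTables p` of tables that vanish wherever `p` does
(`hasFDerivWithinAt_phi`). There are two cases. If every nonempty row has at least two positive
cells, then all conditional probabilities that matter lie in `(0, 1)`, where `f` is differentiable
and negative, so that the conditional variations are positive and the powers and logarithms behave
well. Otherwise some nonempty row is concentrated on one cell; then the geometric mean vanishes for
all nearby supported tables (`eventually_geoMeanVariation_eq_zero`), `Φ_{Gf}` is locally constant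
there, and `δ = 0`.
-/

namespace GeoPRV

/-! ### Slutsky's lemma and the delta method for varying sample spaces -/

/-- If `X n` converges in distribution and `Y n - X n` tends to `0` in probability, then `Y n` has
the same limit in distribution. In contrast to `tendstoInDistribution_of_tendstoInMeasure_sub`,
each `n` may have its own sample space. -/
theorem tendstoInDistribution_of_tendsto_measureReal_sub
    {Ω : ℕ → Type*} [∀ n, MeasurableSpace (Ω n)]
    {μ : (n : ℕ) → Measure (Ω n)} [∀ n, IsProbabilityMeasure (μ n)]
    {Ω' : Type*} [MeasurableSpace Ω'] {μ' : Measure Ω'} [IsProbabilityMeasure μ']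
    {X Y : (n : ℕ) → Ω n → ℝ} {Z : Ω' → ℝ}
    (hX : TendstoInDistribution X atTop Z μ μ')
    (hXY : ∀ ε > 0, Tendsto (fun n => (μ n).real {ω | ε ≤ |Y n ω - X n ω|}) atTop (𝓝 0))
    (hY : ∀ n, AEMeasurable (Y n) (μ n)) :
    TendstoInDistribution Y atTop Z μ μ' := by
  -- On the product of all sample spaces the coordinates have the given laws.
  have hev := fun n => measurePreserving_eval_infinitePi μ n
  have hmap : ∀ {W : (n : ℕ) → Ω n → ℝ}, (∀ n, AEMeasurable (W n) (μ n)) → ∀ n,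
      (Measure.infinitePi μ).map (fun ω => W n (ω n)) = (μ n).map (W n) := by
    intro W hW n
    rw [← (hev n).map_eq, AEMeasurable.map_map_of_aemeasurable _ (hev n).aemeasurable]
    · rfl
    · rw [(hev n).map_eq]; exact hW n
  have hmeas : ∀ {W : (n : ℕ) → Ω n → ℝ}, (∀ n, AEMeasurable (W n) (μ n)) → ∀ n,
      AEMeasurable (fun ω : ∀ n, Ω n => W n (ω n)) (Measure.infinitePi μ) :=
    fun hW n => (hW n).comp_quasiMeasurePreserving (hev n).quasiMeasurePreserving
  have hX' : TendstoInDistribution (fun n (ω : ∀ n, Ω n) => X n (ω n)) atTop Z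
      (fun _ => Measure.infinitePi μ) μ' := by
    refine ⟨hmeas hX.forall_aemeasurable, hX.aemeasurable_limit, ?_⟩
    exact hX.tendsto.congr fun n => Subtype.ext (hmap hX.forall_aemeasurable n).symm
  have hY' := tendstoInDistribution_of_tendstoInMeasure_sub
    (fun n (ω : ∀ n, Ω n) => Y n (ω n)) Z hX' ?_ (hmeas hY)
  · refine ⟨hY, hX.aemeasurable_limit, ?_⟩
    exact hY'.tendsto.congr fun n => Subtype.ext (hmap hY n)
  · rw [tendstoInMeasure_iff_measureReal_norm]
    intro ε hε
    refine (hXY ε hε).congr fun n => ?_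
    have hs : NullMeasurableSet {ω | ε ≤ |Y n ω - X n ω|} (μ n) :=
      nullMeasurableSet_le aemeasurable_const
        ((hY n).sub (hX.forall_aemeasurable n)).norm
    simpa [measureReal_def] using congrArg ENNReal.toReal ((hev n).measure_preimage hs).symm

/-- The remainder estimate of the delta method: if `√n * ‖X n - a‖` is bounded in probability,
`X n` lives on `S`, and `φ` is differentiable at `a` within `S`, then linearizing `φ` at `a` costs
only an error of order `o(1 / √n)` in probability. -/
theorem tendsto_measureReal_linearization_error {E : Type*} [NormedAddCommGroup E]
    [NormedSpace ℝ E] {Ω : ℕ → Type*} [∀ n, MeasurableSpace (Ω n)]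
    {μ : (n : ℕ) → Measure (Ω n)} [∀ n, IsProbabilityMeasure (μ n)]
    {X : (n : ℕ) → Ω n → E} {a : E} {S : Set E} {φ : E → ℝ} {L : E →L[ℝ] ℝ}
    (hφ : HasFDerivWithinAt φ L S a) (hS : ∀ n, ∀ᵐ ω ∂(μ n), X n ω ∈ S)
    (hX : ∀ η > 0, ∃ M : ℝ, ∀ᶠ n : ℕ in atTop, (μ n).real {ω | M < √n * ‖X n ω - a‖} ≤ η)
    {ε : ℝ} (hε : 0 < ε) :
    Tendsto (fun n : ℕ => (μ n).real
      {ω | ε ≤ |√n * (φ (X n ω) - φ a) - √n * L (X n ω - a)|}) atTop (𝓝 0) := by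
  rw [Metric.tendsto_nhds]
  intro η hη
  obtain ⟨M, hM⟩ := hX (η / 2) (by positivity)
  have hM' : 0 < |M| + 1 := by positivity
  obtain ⟨δ, hδ, hδS⟩ := Metric.mem_nhdsWithin_iff.1
    (hφ.isLittleO.def (show 0 < ε / (2 * (|M| + 1)) by positivity))
  have hlarge : ∀ᶠ n : ℕ in atTop, (|M| + 1) / δ < √n :=
    (Real.tendsto_sqrt_atTop.comp tendsto_natCast_atTop_atTop).eventually_gt_atTop _
  filter_upwards [hM, hlarge] with n hn hn'
  rw [Real.dist_0_eq_abs, abs_of_nonneg measureReal_nonneg]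
  refine lt_of_le_of_lt ?_ (show η / 2 < η by linarith)
  refine le_trans ?_ hn
  refine ENNReal.toReal_mono (by finiteness) (measure_mono_ae ?_)
  filter_upwards [hS n] with ω hω hle
  by_contra hlt
  replace hle : ε ≤ |√n * (φ (X n ω) - φ a) - √n * L (X n ω - a)| := hle
  replace hlt : √n * ‖X n ω - a‖ ≤ M := not_lt.1 hlt
  have hsq : 0 < √(n : ℝ) := lt_of_le_of_lt (by positivity) hn'
  have hle1 : √n * ‖X n ω - a‖ < |M| + 1 := by linarith [le_abs_self M]
  have hball : X n ω ∈ Metric.ball a δ := by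
    rw [mem_ball_iff_norm]
    rw [div_lt_iff₀ hδ] at hn'
    exact lt_of_mul_lt_mul_left (hle1.trans hn') hsq.le
  have hrem : ‖φ (X n ω) - φ a - L (X n ω - a)‖ ≤ ε / (2 * (|M| + 1)) * ‖X n ω - a‖ :=
    hδS ⟨hball, hω⟩
  rw [← mul_sub, abs_mul, abs_of_pos hsq] at hle
  rw [Real.norm_eq_abs] at hrem
  have h1 : ε ≤ ε / (2 * (|M| + 1)) * (√n * ‖X n ω - a‖) := by
    calc ε ≤ √n * |φ (X n ω) - φ a - L (X n ω - a)| := hle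
      _ ≤ √n * (ε / (2 * (|M| + 1)) * ‖X n ω - a‖) := by gcongr
      _ = _ := by ring
  have h2 : ε / (2 * (|M| + 1)) * (√n * ‖X n ω - a‖) ≤ ε / (2 * (|M| + 1)) * (|M| + 1) := by
    gcongr
  have h3 : ε / (2 * (|M| + 1)) * (|M| + 1) = ε / 2 := by field_simp
  linarith

/-! ### The central limit theorem for multinomial counts -/

/-- The central limit theorem for characteristic functions, for the centered law that puts mass
`p c` on the point `a c`. -/
theorem tendsto_sum_exp_pow {ι : Type*} [Fintype ι] {p a : ι → ℝ} (hp : ∀ c, 0 ≤ p c)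
    (hsum : ∑ c, p c = 1) (hmean : ∑ c, p c * a c = 0) (t : ℝ) :
    Tendsto (fun n : ℕ => (∑ c, (p c : ℂ) * Complex.exp (((√n)⁻¹ * t * a c : ℝ) * Complex.I)) ^ n)
      atTop (𝓝 (charFun (gaussianReal 0 (∑ c, p c * a c ^ 2).toNNReal) t)) := by
  have hv0 : 0 ≤ ∑ c, p c * a c ^ 2 := Finset.sum_nonneg fun c _ => mul_nonneg (hp c) (sq_nonneg _)
  set v := ∑ c, p c * a c ^ 2 with hv
  rw [charFun_gaussianReal, Real.coe_toNNReal _ hv0]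
  rcases hv0.eq_or_lt with h | h
  · -- The law is degenerate, so every characteristic function involved is constant.
    have hterm : ∀ c, p c = 0 ∨ a c = 0 := fun c => by
      have := (Finset.sum_eq_zero_iff_of_nonneg
        (fun c _ => mul_nonneg (hp c) (sq_nonneg (a c)))).1 (hv.symm.trans h.symm) c
        (Finset.mem_univ c)
      simpa using this
    have hone : ∀ n : ℕ, ∑ c, (p c : ℂ) * Complex.exp (((√n)⁻¹ * t * a c : ℝ) * Complex.I) = 1 := by
      intro n
      have : ∀ c, (p c : ℂ) * Complex.exp (((√n)⁻¹ * t * a c : ℝ) * Complex.I) = p c := by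
        intro c
        rcases hterm c with h | h <;> simp [h]
      simp_rw [this]
      exact_mod_cast hsum
    simp_rw [hone]
    simp [← h]
  · set ν : Measure ℝ := ∑ c, ENNReal.ofReal (p c) • Measure.dirac (a c) with hν
    have hint : ∀ {G : Type} [NormedAddCommGroup G] [NormedSpace ℝ G] [CompleteSpace G] (F : ℝ → G),
        ∫ x, F x ∂ν = ∑ c, p c • F (a c) := by
      intro G _ _ _ F
      rw [hν, integral_finsetSum_measure]
      · simp [integral_smul_measure, ENNReal.toReal_ofReal, hp]
      · intro c _
        exact (integrable_dirac (by simp)).smul_measure (by simp)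
    have hprob : IsProbabilityMeasure ν := by
      constructor
      simp [hν, ← ENNReal.ofReal_sum_of_nonneg (fun c _ => hp c), hsum]
    have key := tendsto_charFun_inv_sqrt_mul_pow (P := ν) (X := fun x => (√v)⁻¹ * x)
      (by fun_prop) ?_ ?_ (√v * t)
    · convert! key using 2 with n
      · congr 1
        rw [charFun_map_mul, charFun_apply_real, hint]
        refine Finset.sum_congr rfl fun c _ => ?_
        have : (√v)⁻¹ * ((√n)⁻¹ * (√v * t)) = (√n)⁻¹ * t := by
          have := (Real.sqrt_pos.2 h).ne'
          field_simp
        rw [Complex.real_smul, this]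
        push_cast
        rfl
      · congr 1
        have : ((√v : ℝ) : ℂ) ^ 2 = v := by exact_mod_cast Real.sq_sqrt hv0
        push_cast
        rw [mul_pow, this]
        ring
    · rw [hint]
      simp only [smul_eq_mul]
      calc ∑ c, p c * ((√v)⁻¹ * a c) = (√v)⁻¹ * ∑ c, p c * a c := by
            rw [Finset.mul_sum]; exact Finset.sum_congr rfl fun c _ => by ring
        _ = 0 := by rw [hmean, mul_zero]
    · rw [hint]
      simp only [smul_eq_mul, Pi.pow_apply, mul_pow, inv_pow, Real.sq_sqrt hv0]
      calc ∑ c, p c * (v⁻¹ * a c ^ 2) = v⁻¹ * v := by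
            rw [hv, Finset.mul_sum]; exact Finset.sum_congr rfl fun c _ => by ring
        _ = 1 := inv_mul_cancel₀ h.ne'

/-- The weights of the multinomial distribution, indexed by the pairs `(i, j)` of the table. -/
theorem IsMultinomial.measureReal_singleton {R C : ℕ} {Ω : Type*} [MeasurableSpace Ω]
    {N : Ω → Fin R → Fin C → ℕ} {n : ℕ} {p : Fin R → Fin C → ℝ} {μ : Measure Ω}
    (h : IsMultinomial N n p μ) (k : Fin R × Fin C → ℕ) :
    (μ.map fun ω (c : Fin R × Fin C) => N ω c.1 c.2).real {k} =
      if ∑ c, k c = n then (Nat.multinomial Finset.univ k : ℝ) * ∏ c, p c.1 c.2 ^ k c else 0 := by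
  have hN := h.measurable
  rw [map_measureReal_apply (by fun_prop) (measurableSet_singleton k)]
  have hset : (fun ω (c : Fin R × Fin C) => N ω c.1 c.2) ⁻¹' {k} =
      {ω | N ω = fun i j => k (i, j)} := by
    ext ω
    simp [funext_iff]
  rw [hset, h.prob_eq]
  simp [Fintype.sum_prod_type, Fintype.prod_prod_type]

theorem IsMultinomial.ae_sum_eq {R C : ℕ} {Ω : Type*} [MeasurableSpace Ω]
    {N : Ω → Fin R → Fin C → ℕ} {n : ℕ} {p : Fin R → Fin C → ℝ} {μ : Measure Ω}
    [IsProbabilityMeasure μ] (h : IsMultinomial N n p μ) :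
    ∀ᵐ ω ∂μ, ∑ c : Fin R × Fin C, N ω c.1 c.2 = n := by
  have hN := h.measurable
  have hmeas : Measurable fun ω (c : Fin R × Fin C) => N ω c.1 c.2 := by fun_prop
  have := Measure.isProbabilityMeasure_map (μ := μ) hmeas.aemeasurable
  refine ae_of_ae_map (p := fun k : Fin R × Fin C → ℕ => ∑ c, k c = n) hmeas.aemeasurable ?_
  rw [ae_iff_of_countable]
  intro k hk
  by_contra hne
  have := h.measureReal_singleton k
  rw [if_neg hne, measureReal_eq_zero_iff] at this
  exact hk this

theorem IsMultinomial.ae_eq_zero {R C : ℕ} {Ω : Type*} [MeasurableSpace Ω]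
    {N : Ω → Fin R → Fin C → ℕ} {n : ℕ} {p : Fin R → Fin C → ℝ} {μ : Measure Ω}
    [IsProbabilityMeasure μ] (h : IsMultinomial N n p μ) :
    ∀ᵐ ω ∂μ, ∀ i j, p i j = 0 → N ω i j = 0 := by
  have hN := h.measurable
  have hmeas : Measurable fun ω (c : Fin R × Fin C) => N ω c.1 c.2 := by fun_prop
  have := Measure.isProbabilityMeasure_map (μ := μ) hmeas.aemeasurable
  refine ae_of_ae_map (p := fun k : Fin R × Fin C → ℕ => ∀ i j, p i j = 0 → k (i, j) = 0)
    hmeas.aemeasurable ?_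
  rw [ae_iff_of_countable]
  intro k hk i j hij
  by_contra hne
  have := h.measureReal_singleton k
  rw [Finset.prod_eq_zero (Finset.mem_univ (i, j)) (by simp [hij, hne])] at this
  rw [mul_zero, ite_self, measureReal_eq_zero_iff] at this
  exact hk this

/-- The probability generating function of the multinomial distribution. -/
theorem IsMultinomial.integral_prod_pow {R C : ℕ} {Ω : Type*} [MeasurableSpace Ω]
    {N : Ω → Fin R → Fin C → ℕ} {n : ℕ} {p : Fin R → Fin C → ℝ} {μ : Measure Ω}
    [IsProbabilityMeasure μ] (h : IsMultinomial N n p μ) (z : Fin R × Fin C → ℂ) :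
    ∫ ω, ∏ c : Fin R × Fin C, z c ^ N ω c.1 c.2 ∂μ = (∑ c, (p c.1 c.2 : ℂ) * z c) ^ n := by
  have hN := h.measurable
  have hmeas : Measurable fun ω (c : Fin R × Fin C) => N ω c.1 c.2 := by fun_prop
  have := Measure.isProbabilityMeasure_map (μ := μ) hmeas.aemeasurable
  set ν := μ.map fun ω (c : Fin R × Fin C) => N ω c.1 c.2 with hν
  have hmap : ∫ ω, ∏ c : Fin R × Fin C, z c ^ N ω c.1 c.2 ∂μ = ∫ k, ∏ c, z c ^ k c ∂ν := by
    rw [hν, integral_map hmeas.aemeasurable]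
    exact (Measurable.of_discrete).aestronglyMeasurable
  have hmem : ∀ᵐ k ∂ν, k ∈ ((Finset.univ.piAntidiag n : Finset (Fin R × Fin C → ℕ)) : Set _) := by
    rw [hν, ae_map_iff hmeas.aemeasurable MeasurableSet.of_discrete]
    filter_upwards [h.ae_sum_eq] with ω hω
    simpa using hω
  rw [hmap, ← Measure.restrict_eq_self_of_ae_mem hmem, setIntegral_finset,
    Finset.sum_pow_eq_sum_piAntidiag]
  · refine Finset.sum_congr rfl fun k hk => ?_
    rw [h.measureReal_singleton, if_pos (Finset.mem_piAntidiag.1 hk).1]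
    simp [mul_pow, Finset.prod_mul_distrib, mul_assoc]
  · exact IntegrableOn.finset

theorem sum_mul_sub_mean_sq {ι : Type*} [Fintype ι] {p : ι → ℝ} (hsum : ∑ c, p c = 1)
    (g : ι → ℝ) :
    ∑ c, p c * (g c - ∑ d, p d * g d) ^ 2 = ∑ c, p c * g c ^ 2 - (∑ c, p c * g c) ^ 2 := by
  set m := ∑ d, p d * g d with hm
  calc ∑ c, p c * (g c - m) ^ 2
      = ∑ c, p c * g c ^ 2 - 2 * m * ∑ c, p c * g c + m ^ 2 * ∑ c, p c := by
        have : ∀ c, p c * (g c - m) ^ 2 = p c * g c ^ 2 - 2 * m * (p c * g c) + m ^ 2 * p c :=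
          fun c => by ring
        simp_rw [this]
        rw [Finset.sum_add_distrib, Finset.sum_sub_distrib, ← Finset.mul_sum, ← Finset.mul_sum]
    _ = _ := by rw [← hm, hsum]; ring

theorem IsMultinomial.aemeasurable_comp {R C : ℕ} {Ω : Type*} [MeasurableSpace Ω]
    {N : Ω → Fin R → Fin C → ℕ} {n : ℕ} {p : Fin R → Fin C → ℝ} {μ : Measure Ω}
    (h : IsMultinomial N n p μ) (F : (Fin R → Fin C → ℕ) → ℝ) :
    AEMeasurable (fun ω => F (N ω)) μ :=
  (Measurable.of_discrete.comp h.measurable).aemeasurable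

section Limits

variable {R C : ℕ} {p : Fin R → Fin C → ℝ} {Ω : ℕ → Type*} [∀ n, MeasurableSpace (Ω n)]
  {μ : (n : ℕ) → Measure (Ω n)} [∀ n, IsProbabilityMeasure (μ n)]
  {N : (n : ℕ) → Ω n → Fin R → Fin C → ℕ}

/-- The central limit theorem for linear functionals of the observed proportions. -/
theorem tendstoInDistribution_linear (hp : ∀ i j, 0 ≤ p i j) (hsum : ∑ i, ∑ j, p i j = 1)
    (hN : ∀ n, IsMultinomial (N n) n p (μ n)) (g : Fin R → Fin C → ℝ) :
    TendstoInDistribution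
      (fun (n : ℕ) (ω : Ω n) =>
        √(n : ℝ) * ∑ i, ∑ j, g i j * (proportions n (N n ω) i j - p i j))
      atTop (id : ℝ → ℝ) μ
      (gaussianReal 0 (∑ i, ∑ j, p i j * g i j ^ 2 - (∑ i, ∑ j, p i j * g i j) ^ 2).toNNReal) := by
  have hmeas : ∀ n, AEMeasurable (fun ω : Ω n =>
      √(n : ℝ) * ∑ i, ∑ j, g i j * (proportions n (N n ω) i j - p i j)) (μ n) := fun n =>
    (hN n).aemeasurable_comp fun k => √(n : ℝ) * ∑ i, ∑ j, g i j * (proportions n k i j - p i j)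
  refine ⟨hmeas, aemeasurable_id, ProbabilityMeasure.tendsto_iff_tendsto_charFun.2 fun t => ?_⟩
  simp only [ProbabilityMeasure.coe_mk, Measure.map_id]
  have hsum' : ∑ c : Fin R × Fin C, p c.1 c.2 = 1 := by rw [Fintype.sum_prod_type, hsum]
  set m := ∑ c : Fin R × Fin C, p c.1 c.2 * g c.1 c.2 with hm
  have hlim := tendsto_sum_exp_pow (p := fun c : Fin R × Fin C => p c.1 c.2)
    (a := fun c => g c.1 c.2 - m) (fun c => hp c.1 c.2) hsum' (by
      simp only [mul_sub, Finset.sum_sub_distrib, ← Finset.sum_mul, hsum']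
      rw [← hm]; ring) t
  rw [sum_mul_sub_mean_sq hsum' (fun c => g c.1 c.2)] at hlim
  simp only [hm, Fintype.sum_prod_type] at hlim
  refine hlim.congr' ?_
  filter_upwards [eventually_gt_atTop 0] with n hn
  have hn' : (0 : ℝ) < n := by exact_mod_cast hn
  rw [charFun_apply_real, integral_map (hmeas n) (by fun_prop)]
  have hgen := (hN n).integral_prod_pow
    (fun c => Complex.exp (((√n)⁻¹ * t * (g c.1 c.2 - m) : ℝ) * Complex.I))
  simp only [hm, Fintype.sum_prod_type] at hgen
  rw [← hgen]
  refine integral_congr_ae ?_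
  filter_upwards [(hN n).ae_sum_eq] with ω hω
  rw [Fintype.sum_prod_type] at hω
  simp_rw [← Complex.exp_nat_mul, ← Complex.exp_sum]
  congr 1
  have hω' : ∑ i, ∑ j, (N n ω i j : ℝ) = n := by exact_mod_cast hω
  set m' := ∑ i, ∑ j, p i j * g i j with hm'
  have hreal : ∑ i, ∑ j, (N n ω i j : ℝ) * ((√n)⁻¹ * t * (g i j - m')) =
      t * (√(n : ℝ) * ∑ i, ∑ j, g i j * (proportions n (N n ω) i j - p i j)) := by
    have hs : √(n : ℝ) ≠ 0 := (Real.sqrt_pos.2 hn').ne'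
    have hss : √(n : ℝ) * √(n : ℝ) = n := Real.mul_self_sqrt hn'.le
    have e1 : ∑ i, ∑ j, (N n ω i j : ℝ) * ((√n)⁻¹ * t * (g i j - m')) =
        (√n)⁻¹ * t * (∑ i, ∑ j, g i j * N n ω i j - n * m') := by
      rw [← hω']
      simp only [Finset.mul_sum, Finset.sum_mul, ← Finset.sum_sub_distrib]
      exact Finset.sum_congr rfl fun i _ => Finset.sum_congr rfl fun j _ => by ring
    have e2 : ∑ i, ∑ j, g i j * (proportions n (N n ω) i j - p i j) =
        (n : ℝ)⁻¹ * (∑ i, ∑ j, g i j * N n ω i j - n * m') := by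
      rw [mul_sub, ← mul_assoc, inv_mul_cancel₀ hn'.ne', one_mul, hm']
      simp only [Finset.mul_sum, ← Finset.sum_sub_distrib]
      exact Finset.sum_congr rfl fun i _ => Finset.sum_congr rfl fun j _ => by
        simp only [proportions]; ring
    rw [e1, e2]
    have e3 : (√(n : ℝ))⁻¹ = √n * (n : ℝ)⁻¹ := by
      rw [eq_mul_inv_iff_mul_eq₀ hn'.ne', inv_mul_eq_iff_eq_mul₀ hs, hss]
    rw [e3]; ring
  have hcast := congrArg (fun x : ℝ => (x : ℂ) * Complex.I) hreal
  rw [Fintype.sum_prod_type]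
  push_cast at hcast ⊢
  rw [← hcast]
  simp only [Finset.sum_mul]
  exact Finset.sum_congr rfl fun i _ => Finset.sum_congr rfl fun j _ => by ring

/-- The observed proportions deviate from the cell probabilities by `O(1 / √n)` in probability. -/
theorem exists_measureReal_norm_proportions_sub_le (hp : ∀ i j, 0 ≤ p i j)
    (hsum : ∑ i, ∑ j, p i j = 1) (hN : ∀ n, IsMultinomial (N n) n p (μ n)) {η : ℝ} (hη : 0 < η) :
    ∃ M : ℝ, ∀ n : ℕ,
      (μ n).real {ω | M < √n * ‖proportions n (N n ω) - p‖} ≤ η := by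
  have hRC : 0 < ((R : ℝ) * C + 1) := by positivity
  -- each cell is tight, by the convergence of its characteristic functions
  have hcell : ∀ i j, ∃ M : ℝ, ∀ n : ℕ,
      (μ n).real {ω | M < √n * |proportions n (N n ω) i j - p i j|} ≤ η / (R * C + 1) := by
    intro i j
    have hlim := tendstoInDistribution_linear hp hsum hN
      (fun i' j' => if i' = i ∧ j' = j then 1 else 0)
    have hX : ∀ (n : ℕ) (ω : Ω n), √(n : ℝ) * ∑ i', ∑ j', (if i' = i ∧ j' = j then (1 : ℝ) else 0) *
        (proportions n (N n ω) i' j' - p i' j') =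
        √(n : ℝ) * (proportions n (N n ω) i j - p i j) := by
      intro n ω
      simp [ite_and]
    simp only [hX] at hlim
    have hpr := fun n => Measure.isProbabilityMeasure_map (hlim.forall_aemeasurable n)
    have hgauss := Measure.isProbabilityMeasure_map hlim.aemeasurable_limit
    have htight := isTightMeasureSet_of_tendsto_charFun
      (μ := fun n => (μ n).map fun ω => √(n : ℝ) * (proportions n (N n ω) i j - p i j))
      (f := charFun ((gaussianReal 0 _).map id)) continuous_charFun.continuousAt
      (ProbabilityMeasure.tendsto_iff_tendsto_charFun.1 hlim.tendsto)
    rw [isTightMeasureSet_iff_tendsto_measure_norm_gt] at htight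
    obtain ⟨M, hM⟩ := (htight.eventually_lt_const
      (show (0 : ENNReal) < ENNReal.ofReal (η / (R * C + 1)) by
        simpa using div_pos hη hRC)).exists
    refine ⟨M, fun n => ?_⟩
    refine ENNReal.toReal_le_of_le_ofReal (by positivity) (le_trans ?_ hM.le)
    refine le_trans (le_of_eq ?_) (le_iSup₂_of_le _ ⟨n, rfl⟩ le_rfl)
    rw [Measure.map_apply_of_aemeasurable (hlim.forall_aemeasurable n)
      (measurableSet_lt measurable_const measurable_norm)]
    congr 1
    ext ω
    simp [abs_mul, abs_of_nonneg (Real.sqrt_nonneg _)]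
  choose M hM using hcell
  have hMle : ∀ i j, M i j ≤ ∑ i, ∑ j, |M i j| := fun i j =>
    (le_abs_self _).trans <| (Finset.single_le_sum (f := fun j => |M i j|)
      (fun _ _ => abs_nonneg _) (Finset.mem_univ j)).trans <|
      Finset.single_le_sum (f := fun i => ∑ j, |M i j|)
        (fun _ _ => Finset.sum_nonneg fun _ _ => abs_nonneg _) (Finset.mem_univ i)
  refine ⟨∑ i, ∑ j, |M i j|, fun n => ?_⟩
  have hsub : {ω | ∑ i, ∑ j, |M i j| < √n * ‖proportions n (N n ω) - p‖} ⊆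
      ⋃ c : Fin R × Fin C, {ω | M c.1 c.2 < √n * |proportions n (N n ω) c.1 c.2 - p c.1 c.2|} := by
    intro ω hω
    by_contra hnot
    simp only [Set.mem_iUnion, Set.mem_ofPred_eq, not_exists, not_lt, Prod.forall] at hnot hω
    refine absurd hω (not_lt.2 ?_)
    have hM0 : 0 ≤ ∑ i, ∑ j, |M i j| :=
      Finset.sum_nonneg fun _ _ => Finset.sum_nonneg fun _ _ => abs_nonneg _
    have : ‖√(n : ℝ) • (proportions n (N n ω) - p)‖ ≤ ∑ i, ∑ j, |M i j| := by
      refine (pi_norm_le_iff_of_nonneg hM0).2 fun i => (pi_norm_le_iff_of_nonneg hM0).2 fun j => ?_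
      simpa [abs_mul, abs_of_nonneg (Real.sqrt_nonneg _)] using (hnot i j).trans (hMle i j)
    simpa [norm_smul, abs_of_nonneg (Real.sqrt_nonneg _)] using this
  calc (μ n).real {ω | ∑ i, ∑ j, |M i j| < √n * ‖proportions n (N n ω) - p‖}
      ≤ ∑ c : Fin R × Fin C,
          (μ n).real {ω | M c.1 c.2 < √n * |proportions n (N n ω) c.1 c.2 - p c.1 c.2|} :=
        (measureReal_mono hsub).trans (measureReal_iUnion_fintype_le _)
    _ ≤ ∑ _c : Fin R × Fin C, η / (R * C + 1) := Finset.sum_le_sum fun c _ => hM c.1 c.2 n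
    _ = (R * C) * (η / (R * C + 1)) := by simp
    _ ≤ (R * C + 1) * (η / (R * C + 1)) := by gcongr; linarith
    _ = η := by field_simp

end Limits

/-! ### Differentiability of the measure along the support of the cell probabilities -/

/-- Derivatives within `S` may be altered off the directions `x - a`, `x ∈ S`. -/
theorem hasFDerivWithinAt_congr_fderiv_sub {E : Type*} [NormedAddCommGroup E] [NormedSpace ℝ E]
    {φ : E → ℝ} {L L' : E →L[ℝ] ℝ} {S : Set E} {a : E} (h : HasFDerivWithinAt φ L S a)
    (hL : ∀ x ∈ S, L (x - a) = L' (x - a)) : HasFDerivWithinAt φ L' S a := by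
  rw [hasFDerivWithinAt_iff_isLittleO] at h ⊢
  refine h.congr' ?_ .rfl
  filter_upwards [self_mem_nhdsWithin] with x hx
  rw [hL x hx]

/-- A nonzero convex function on `[0, 1]` that vanishes at both ends is negative inside. -/
theorem IsGenerator.neg_of_ne_zero {f : ℝ → ℝ} (hf : IsGenerator f) {x₀ : ℝ}
    (hx₀ : x₀ ∈ Set.Ioo (0 : ℝ) 1) (hne : f x₀ ≠ 0) {x : ℝ} (hx : x ∈ Set.Ioo (0 : ℝ) 1) :
    f x < 0 := by
  have hconv := hf.convexOn.2
  have h0 : (0 : ℝ) ∈ Set.Icc (0 : ℝ) 1 := by simp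
  have h1 : (1 : ℝ) ∈ Set.Icc (0 : ℝ) 1 := by simp
  have hfx₀ : f x₀ < 0 := by
    refine lt_of_le_of_ne ?_ hne
    have := hconv h0 h1 (by linarith [hx₀.2] : 0 ≤ 1 - x₀) hx₀.1.le (by ring)
    simpa [hf.map_zero, hf.map_one] using this
  have hmem : x₀ ∈ Set.Icc (0 : ℝ) 1 := Set.Ioo_subset_Icc_self hx₀
  rcases le_total x x₀ with hle | hle
  · have := hconv h0 hmem (a := 1 - x / x₀) (b := x / x₀)
      (sub_nonneg.2 ((div_le_one hx₀.1).2 hle)) (div_nonneg hx.1.le hx₀.1.le) (by ring)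
    simp only [smul_eq_mul, mul_zero, zero_add, hf.map_zero, div_mul_cancel₀ x hx₀.1.ne'] at this
    exact this.trans_lt (mul_neg_of_pos_of_neg (div_pos hx.1 hx₀.1) hfx₀)
  · have hx₀' : 0 < 1 - x₀ := sub_pos.2 hx₀.2
    have hx' : 0 < 1 - x := sub_pos.2 hx.2
    have := hconv hmem h1 (a := (1 - x) / (1 - x₀)) (b := 1 - (1 - x) / (1 - x₀))
      (by positivity) (sub_nonneg.2 ((div_le_one hx₀').2 (by linarith))) (by ring)
    have hcomb : (1 - x) / (1 - x₀) * x₀ + (1 - (1 - x) / (1 - x₀)) * 1 = x := by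
      field_simp
      ring
    simp only [smul_eq_mul, hf.map_one, mul_zero, add_zero, hcomb] at this
    exact this.trans_lt (mul_neg_of_pos_of_neg (by positivity) hfx₀)

section Gradient

variable {R C : ℕ}

/-- The tables that vanish wherever `p` does. The observed proportions are almost surely among
them. -/
def supportedTables (p : Fin R → Fin C → ℝ) : Set (Fin R → Fin C → ℝ) :=
  {q | ∀ i j, p i j = 0 → q i j = 0}

/-- The coordinate functional `q ↦ q i j`. -/
def cell (i : Fin R) (j : Fin C) : (Fin R → Fin C → ℝ) →L[ℝ] ℝ :=
  (ContinuousLinearMap.proj (R := ℝ) (φ := fun _ : Fin C => ℝ) j).comp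
    (ContinuousLinearMap.proj (R := ℝ) (φ := fun _ : Fin R => Fin C → ℝ) i)

@[simp]
theorem cell_apply (i : Fin R) (j : Fin C) (q : Fin R → Fin C → ℝ) : cell i j q = q i j := rfl

theorem hasFDerivAt_rowSum (p : Fin R → Fin C → ℝ) (i : Fin R) :
    HasFDerivAt (fun q : Fin R → Fin C → ℝ => rowSum q i) (∑ j, cell i j) p := by
  convert! (∑ j, cell (C := C) i j).hasFDerivAt (x := p) using 1
  ext q
  simp [rowSum]

theorem hasFDerivAt_colSum (p : Fin R → Fin C → ℝ) (j : Fin C) :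
    HasFDerivAt (fun q : Fin R → Fin C → ℝ => colSum q j) (∑ i, cell i j) p := by
  convert! (∑ i, cell (R := R) i j).hasFDerivAt (x := p) using 1
  ext q
  simp [colSum]

variable {f : ℝ → ℝ} {p : Fin R → Fin C → ℝ}

/-- No column carries all of the mass, for otherwise the marginal variation would vanish. -/
theorem colSum_lt_one (hf : IsGenerator f) (hsum : ∑ i, ∑ j, p i j = 1)
    (hcol : ∀ j, 0 < colSum p j) (hV : marginalVariation f p ≠ 0) (j : Fin C) :
    colSum p j < 1 := by
  have htot : ∑ j, colSum p j = 1 := by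
    rw [← hsum, Finset.sum_comm]; rfl
  by_contra hge
  refine hV ?_
  have huniq : ∀ k, k = j := fun k => by
    by_contra hkj
    have := Finset.add_le_sum (f := colSum p) (fun k _ => (hcol k).le) (Finset.mem_univ k)
      (Finset.mem_univ j) hkj
    linarith [hcol k]
  have hone : colSum p j = 1 := by
    rw [← htot]
    exact (Finset.sum_eq_single j (fun k _ hk => absurd (huniq k) hk) (by simp)).symm
  simp [marginalVariation, fun k => huniq k, hone, hf.map_one]

/-- A nonzero marginal variation forces the generator to be negative on `(0, 1)`. -/
theorem generator_neg (hf : IsGenerator f) (hsum : ∑ i, ∑ j, p i j = 1)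
    (hcol : ∀ j, 0 < colSum p j) (hV : marginalVariation f p ≠ 0) {x : ℝ}
    (hx : x ∈ Set.Ioo (0 : ℝ) 1) : f x < 0 := by
  obtain ⟨j, -, hj⟩ := Finset.exists_ne_zero_of_sum_ne_zero (neg_ne_zero.1 hV)
  exact hf.neg_of_ne_zero ⟨hcol j, colSum_lt_one hf hsum hcol hV j⟩ hj hx

theorem hasFDerivAt_marginalVariation (hf' : DifferentiableOn ℝ f (Set.Ioo 0 1))
    (hcol : ∀ j, colSum p j ∈ Set.Ioo (0 : ℝ) 1) :
    HasFDerivAt (fun q : Fin R → Fin C → ℝ => marginalVariation f q)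
      (-∑ j, deriv f (colSum p j) • ∑ i, cell i j) p := by
  refine (HasFDerivAt.fun_sum fun j _ => ?_).fun_neg
  exact ((hf'.differentiableAt (Ioo_mem_nhds (hcol j).1 (hcol j).2)).hasDerivAt).comp_hasFDerivAt p
    (hasFDerivAt_colSum p j)

/-- Cells with `p i j = 0` contribute the constant `f 0 = 0` along the support of `p`, so that
their formal derivative, with the arbitrary number `deriv f 0`, is correct there. -/
theorem hasFDerivWithinAt_conditionalVariation (hf : IsGenerator f)
    (hf' : DifferentiableOn ℝ f (Set.Ioo 0 1)) (hp : ∀ i j, 0 ≤ p i j) {i : Fin R}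
    (hrow : 0 < rowSum p i) (hlt : ∀ j, p i j < rowSum p i) :
    HasFDerivWithinAt (fun q : Fin R → Fin C → ℝ => conditionalVariation f q i)
      (-∑ j, deriv f (p i j / rowSum p i) •
        ((rowSum p i)⁻¹ • cell i j - (p i j / rowSum p i ^ 2) • ∑ t, cell i t))
      (supportedTables p) p := by
  refine (HasFDerivWithinAt.fun_sum fun j _ => ?_).fun_neg
  rcases (hp i j).eq_or_lt with h0 | hpos
  · refine hasFDerivWithinAt_congr_fderiv_sub (L := 0) ?_ fun x hx => ?_
    · refine (hasFDerivWithinAt_const (0 : ℝ) p _).congr (fun x hx => ?_) ?_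
      · rw [hx i j h0.symm, zero_div, hf.map_zero]
      · rw [← h0, zero_div, hf.map_zero]
    · simp [← h0, hx i j h0.symm]
  · have hinv : HasFDerivAt (fun q : Fin R → Fin C → ℝ => (rowSum q i)⁻¹)
        (-(rowSum p i ^ 2)⁻¹ • ∑ t, cell i t) p :=
      (hasDerivAt_inv hrow.ne').comp_hasFDerivAt p (hasFDerivAt_rowSum p i)
    have hquot := ((cell i j).hasFDerivAt (x := p)).mul hinv
    have hx : p i j / rowSum p i ∈ Set.Ioo (0 : ℝ) 1 :=
      ⟨div_pos hpos hrow, (div_lt_one hrow).2 (hlt j)⟩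
    have hd := (hf'.differentiableAt (Ioo_mem_nhds hx.1 hx.2)).hasDerivAt
    rw [div_eq_mul_inv] at hd
    have hcomp := (HasDerivAt.comp_hasFDerivAt (h₂ := f)
      (f := (cell i j : (Fin R → Fin C → ℝ) → ℝ) * fun q => (rowSum q i)⁻¹) p hd
        hquot).hasFDerivWithinAt (s := supportedTables p)
    convert! hcomp using 1
    rw [div_eq_mul_inv]
    congr 1
    ext q
    simp [div_eq_mul_inv]
    ring

theorem conditionalVariation_pos (hf : IsGenerator f) (hneg : ∀ x ∈ Set.Ioo (0 : ℝ) 1, f x < 0)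
    (hp : ∀ i j, 0 ≤ p i j) {i : Fin R} (hrow : 0 < rowSum p i)
    (hlt : ∀ j, p i j < rowSum p i) : 0 < conditionalVariation f p i := by
  obtain ⟨j, -, hj⟩ := Finset.exists_ne_zero_of_sum_ne_zero (show rowSum p i ≠ 0 from hrow.ne')
  have hterm : ∀ t, p i t ≠ 0 → f (p i t / rowSum p i) < 0 := fun t ht =>
    hneg _ ⟨div_pos ((hp i t).lt_of_ne' ht) hrow, (div_lt_one hrow).2 (hlt t)⟩
  refine neg_pos.2 (Finset.sum_neg' (fun t _ => ?_) ⟨j, Finset.mem_univ j, hterm j hj⟩)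
  by_cases ht : p i t = 0
  · rw [ht, zero_div, hf.map_zero]
  · exact (hterm t ht).le

/-- The logarithmic derivative of the `i`-th factor of the geometric mean has the coefficients
`eps f p i j`. -/
theorem hasFDerivWithinAt_conditionalVariation_rpow (hf : IsGenerator f)
    (hf' : DifferentiableOn ℝ f (Set.Ioo 0 1)) (hneg : ∀ x ∈ Set.Ioo (0 : ℝ) 1, f x < 0)
    (hp : ∀ i j, 0 ≤ p i j) {i : Fin R}
    (hlt : 0 < rowSum p i → ∀ j, p i j < rowSum p i) :
    HasFDerivWithinAt (fun q : Fin R → Fin C → ℝ => conditionalVariation f q i ^ rowSum q i)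
      ((conditionalVariation f p i ^ rowSum p i) • ∑ j, eps f p i j • cell i j)
      (supportedTables p) p := by
  have hrow0 : 0 ≤ rowSum p i := Finset.sum_nonneg fun j _ => hp i j
  rcases hrow0.eq_or_lt with hrow | hrow
  · -- an empty row stays empty along the support, and its factor stays `1`
    have hzero : ∀ j, p i j = 0 := fun j =>
      (Finset.sum_eq_zero_iff_of_nonneg fun j _ => hp i j).1 hrow.symm j (Finset.mem_univ j)
    refine hasFDerivWithinAt_congr_fderiv_sub (L := 0) ?_ fun x hx => ?_
    · refine (hasFDerivWithinAt_const (1 : ℝ) p _).congr (fun x hx => ?_) ?_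
      · have : rowSum x i = 0 := Finset.sum_eq_zero fun j _ => hx i j (hzero j)
        rw [this, Real.rpow_zero]
      · rw [← hrow, Real.rpow_zero]
    · simp [hzero, fun j => hx i j (hzero j)]
  · have hpos := conditionalVariation_pos hf hneg hp hrow (hlt hrow)
    convert! (hasFDerivWithinAt_conditionalVariation hf hf' hp hrow (hlt hrow)).rpow
      (hasFDerivAt_rowSum p i).hasFDerivWithinAt hpos using 1
    ext h
    have hrow' := hrow.ne'
    have hsumV : ∑ t, f (p i t / rowSum p i) = -conditionalVariation f p i := by
      simp [conditionalVariation]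
    have hpow : conditionalVariation f p i ^ (rowSum p i - 1) =
        conditionalVariation f p i ^ rowSum p i * (conditionalVariation f p i)⁻¹ := by
      rw [Real.rpow_sub_one hpos.ne', div_eq_mul_inv]
    simp only [eps, hsumV, hpow]
    set V := conditionalVariation f p i
    set r := rowSum p i
    set d := fun j => deriv f (p i j / r) with hd
    have e1 : ∑ j, (Real.log V + ((∑ t, -(p i t / r * d t)) + d j) / -V) * h i j =
        Real.log V * ∑ j, h i j +
          V⁻¹ * ((∑ t, p i t / r * d t) * ∑ j, h i j - ∑ j, d j * h i j) := by
      rw [Finset.sum_neg_distrib]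
      generalize ∑ t, p i t / r * d t = A
      rw [Finset.mul_sum, Finset.mul_sum, ← Finset.sum_sub_distrib, Finset.mul_sum,
        ← Finset.sum_add_distrib]
      refine Finset.sum_congr rfl fun j _ => ?_
      field_simp
      ring
    have e2 : ∑ j, d j * (r⁻¹ * h i j - p i j / r ^ 2 * ∑ t, h i t) =
        r⁻¹ * (∑ j, d j * h i j - (∑ t, p i t / r * d t) * ∑ j, h i j) := by
      generalize ∑ t, h i t = H
      rw [Finset.sum_mul, ← Finset.sum_sub_distrib, Finset.mul_sum]
      refine Finset.sum_congr rfl fun j _ => ?_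
      field_simp
    simp only [smul_apply, add_apply,
      neg_apply, sum_apply, sub_apply,
      cell_apply, smul_eq_mul]
    rw [e1, e2]
    field_simp
    ring

/-- The gradient of the geometric mean when no row is concentrated on a single cell. -/
theorem hasFDerivWithinAt_geoMeanVariation (hf : IsGenerator f)
    (hf' : DifferentiableOn ℝ f (Set.Ioo 0 1)) (hneg : ∀ x ∈ Set.Ioo (0 : ℝ) 1, f x < 0)
    (hp : ∀ i j, 0 ≤ p i j) (hlt : ∀ i, 0 < rowSum p i → ∀ j, p i j < rowSum p i) :
    HasFDerivWithinAt (fun q : Fin R → Fin C → ℝ => geoMeanVariation f q)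
      (geoMeanVariation f p • ∑ i, ∑ j, eps f p i j • cell i j) (supportedTables p) p := by
  convert! HasFDerivWithinAt.finsetProd (u := Finset.univ) fun i _ =>
    hasFDerivWithinAt_conditionalVariation_rpow hf hf' hneg hp (hlt i) using 1
  rw [Finset.smul_sum]
  refine Finset.sum_congr rfl fun i _ => ?_
  rw [smul_smul, Finset.prod_erase_mul _ _ (Finset.mem_univ i)]
  rfl

/-- If some row is concentrated on one cell, then so is the same row of every nearby table on the
support of `p`; hence the geometric mean vanishes near `p`. -/
theorem eventually_geoMeanVariation_eq_zero (hf : IsGenerator f) (hp : ∀ i j, 0 ≤ p i j)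
    {i : Fin R} {j : Fin C} (hrow : 0 < rowSum p i) (hij : rowSum p i ≤ p i j) :
    ∀ᶠ q in 𝓝[supportedTables p] p, geoMeanVariation f q = 0 := by
  have hother : ∀ t, t ≠ j → p i t = 0 := fun t ht => by
    have := Finset.add_le_sum (f := p i) (fun k _ => hp i k) (Finset.mem_univ t)
      (Finset.mem_univ j) ht
    have hr : rowSum p i = ∑ t, p i t := rfl
    linarith [hp i t]
  have hnear : ∀ᶠ q in 𝓝[supportedTables p] p, 0 < rowSum q i :=
    ((hasFDerivAt_rowSum p i).continuousAt.eventually_const_lt hrow).filter_mono inf_le_left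
  filter_upwards [hnear, self_mem_nhdsWithin] with q hq hqS
  have hqj : rowSum q i = q i j :=
    Finset.sum_eq_single j (fun t _ ht => hqS i t (hother t ht)) (by simp)
  refine Finset.prod_eq_zero (Finset.mem_univ i) ?_
  have hV : conditionalVariation f q i = 0 := by
    refine neg_eq_zero.2 (Finset.sum_eq_zero fun t _ => ?_)
    by_cases ht : t = j
    · rw [ht, hqj, div_self (hqj ▸ hq.ne'), hf.map_one]
    · rw [hqS i t (hother t ht), zero_div, hf.map_zero]
  rw [hV, Real.zero_rpow hq.ne']

/-- The gradient of `Φ_{Gf}` along the support of `p`. -/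
theorem hasFDerivWithinAt_phi (hf : IsGenerator f) (hf' : DifferentiableOn ℝ f (Set.Ioo 0 1))
    (hp : ∀ i j, 0 ≤ p i j) (hsum : ∑ i, ∑ j, p i j = 1) (hcol : ∀ j, 0 < colSum p j)
    (hV : marginalVariation f p ≠ 0) :
    HasFDerivWithinAt (fun q : Fin R → Fin C → ℝ => phi f q)
      (∑ i, ∑ j, (-(delta f p * Delta f p i j)) • cell i j) (supportedTables p) p := by
  have hneg : ∀ x ∈ Set.Ioo (0 : ℝ) 1, f x < 0 := fun x hx => generator_neg hf hsum hcol hV hx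
  have hVd := (hasFDerivAt_marginalVariation hf' fun j =>
    ⟨hcol j, colSum_lt_one hf hsum hcol hV j⟩)
  have hS : p ∈ supportedTables p := fun _ _ h => h
  by_cases hlt : ∀ i, 0 < rowSum p i → ∀ j, p i j < rowSum p i
  · have hGd := hasFDerivWithinAt_geoMeanVariation hf hf' hneg hp hlt
    have hinv : HasFDerivAt (fun q : Fin R → Fin C → ℝ => (marginalVariation f q)⁻¹) _ p :=
      (hasDerivAt_inv hV).comp_hasFDerivAt p hVd
    have hmul := (hVd.hasFDerivWithinAt.fun_sub hGd).mul hinv.hasFDerivWithinAt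
    convert! hmul using 1
    ext h
    have hsumV : ∑ t, f (colSum p t) = -marginalVariation f p := by simp [marginalVariation]
    simp only [smul_apply, add_apply,
      neg_apply, sum_apply, sub_apply,
      cell_apply, smul_eq_mul, delta, Delta, hsumV]
    set V := marginalVariation f p
    set G := geoMeanVariation f p
    have e1 : ∑ i, ∑ j, -(G / (-V) ^ 2 * (deriv f (colSum p j) - eps f p i j * -V)) * h i j =
        -(G / V ^ 2 * (∑ j, deriv f (colSum p j) * ∑ i, h i j
          + V * ∑ i, ∑ j, eps f p i j * h i j)) := by
      have hcomm : ∑ j, deriv f (colSum p j) * ∑ i, h i j =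
          ∑ i, ∑ j, deriv f (colSum p j) * h i j := by
        simp_rw [Finset.mul_sum]
        exact Finset.sum_comm
      rw [hcomm, neg_sq]
      simp only [Finset.mul_sum, ← Finset.sum_add_distrib, ← Finset.sum_neg_distrib]
      exact Finset.sum_congr rfl fun i _ => Finset.sum_congr rfl fun j _ => by ring
    rw [e1]
    field_simp
    ring
  · push Not at hlt
    obtain ⟨i, hrow, j, hij⟩ := hlt
    have hG := eventually_geoMeanVariation_eq_zero hf hp hrow hij
    have hGp : geoMeanVariation f p = 0 := hG.self_of_nhdsWithin hS
    have hVq : ∀ᶠ q in 𝓝[supportedTables p] p, marginalVariation f q ≠ 0 :=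
      (hVd.continuousAt.eventually_ne hV).filter_mono inf_le_left
    have hL : ∑ i, ∑ j, (-(delta f p * Delta f p i j)) • cell i j = 0 := by
      simp [delta, hGp]
    rw [hL]
    refine (hasFDerivWithinAt_const (1 : ℝ) p _).congr_of_eventuallyEq ?_ ?_
    · filter_upwards [hG, hVq] with q hq hqV
      simp [phi, hq, hqV]
    · simp [phi, hGp, hV]

end Gradient

/-! ### The asymptotic variance -/

/-- The number `σ²[Φ_{Gf}]` is the variance, under `p`, of the gradient of `Φ_{Gf}`. -/
theorem sigmaSq_eq_gradient_variance {R C : ℕ} (f : ℝ → ℝ) (p : Fin R → Fin C → ℝ) :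
    sigmaSq f p = ∑ i, ∑ j, p i j * (-(delta f p * Delta f p i j)) ^ 2 -
      (∑ i, ∑ j, p i j * (-(delta f p * Delta f p i j))) ^ 2 := by
  have h1 : ∑ i, ∑ j, p i j * (-(delta f p * Delta f p i j)) ^ 2 =
      delta f p ^ 2 * ∑ i, ∑ j, p i j * Delta f p i j ^ 2 := by
    simp only [Finset.mul_sum]
    exact Finset.sum_congr rfl fun i _ => Finset.sum_congr rfl fun j _ => by ring
  have h2 : ∑ i, ∑ j, p i j * (-(delta f p * Delta f p i j)) =
      -delta f p * ∑ i, ∑ j, p i j * Delta f p i j := by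
    simp only [Finset.mul_sum]
    exact Finset.sum_congr rfl fun i _ => Finset.sum_congr rfl fun j _ => by ring
  rw [h1, h2, sigmaSq]
  ring

theorem sigmaSq_nonneg {R C : ℕ} (f : ℝ → ℝ) {p : Fin R → Fin C → ℝ} (hp : ∀ i j, 0 ≤ p i j)
    (hsum : ∑ i, ∑ j, p i j = 1) : 0 ≤ sigmaSq f p := by
  have hsum' : ∑ c : Fin R × Fin C, p c.1 c.2 = 1 := by rw [Fintype.sum_prod_type, hsum]
  have h := sum_mul_sub_mean_sq hsum' fun c => Delta f p c.1 c.2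
  simp only [Fintype.sum_prod_type] at h
  rw [sigmaSq, ← h]
  exact mul_nonneg (sq_nonneg _) (Finset.sum_nonneg fun i _ => Finset.sum_nonneg fun j _ =>
    mul_nonneg (hp i j) (sq_nonneg _))

end GeoPRV

theorem theorem3 {R C : ℕ} (f : ℝ → ℝ) (hf : GeoPRV.IsGenerator f)
    (hf' : DifferentiableOn ℝ f (Set.Ioo 0 1))
    (p : Fin R → Fin C → ℝ) (hp : ∀ i j, 0 ≤ p i j) (hsum : ∑ i, ∑ j, p i j = 1)
    (hcol : ∀ j, 0 < GeoPRV.colSum p j) (hV : GeoPRV.marginalVariation f p ≠ 0)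
    {Ω : ℕ → Type*} [∀ n, MeasurableSpace (Ω n)]
    (μ : (n : ℕ) → Measure (Ω n)) [∀ n, IsProbabilityMeasure (μ n)]
    (N : (n : ℕ) → Ω n → Fin R → Fin C → ℕ)
    (hN : ∀ n, GeoPRV.IsMultinomial (N n) n p (μ n)) :
    0 ≤ GeoPRV.sigmaSq f p ∧
      TendstoInDistribution
        (fun (n : ℕ) (ω : Ω n) => √(n : ℝ) *
          (GeoPRV.phi f (GeoPRV.proportions n (N n ω)) - GeoPRV.phi f p))
        atTop (id : ℝ → ℝ) μ (gaussianReal 0 (GeoPRV.sigmaSq f p).toNNReal) := by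
  refine ⟨GeoPRV.sigmaSq_nonneg f hp hsum, ?_⟩
  have hlin := GeoPRV.tendstoInDistribution_linear hp hsum hN
    fun i j => -(GeoPRV.delta f p * GeoPRV.Delta f p i j)
  simp only [← GeoPRV.sigmaSq_eq_gradient_variance] at hlin
  refine GeoPRV.tendstoInDistribution_of_tendsto_measureReal_sub hlin (fun ε hε => ?_) fun n =>
    (hN n).aemeasurable_comp fun k =>
      √(n : ℝ) * (GeoPRV.phi f (GeoPRV.proportions n k) - GeoPRV.phi f p)
  have herr := GeoPRV.tendsto_measureReal_linearization_error
    (X := fun (n : ℕ) (ω : Ω n) => GeoPRV.proportions n (N n ω))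
    (GeoPRV.hasFDerivWithinAt_phi hf hf' hp hsum hcol hV)
    (fun n => by
      filter_upwards [(hN n).ae_eq_zero] with ω hω i j hij
      simp [GeoPRV.proportions, hω i j hij])
    (fun η hη => (GeoPRV.exists_measureReal_norm_proportions_sub_le hp hsum hN hη).imp
      fun _ hM => .of_forall hM) hε
  simpa using herr
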